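/- Let $m,N$ be natural numbers. For $i\in\{1,\dots,m\}$ let $H_i:\mathbb R^N\times\mathbb R^N\to\mathbb R$ be Hamiltonians such that: $H_i$ is uniformly continuous on $\mathbb R^N\times B_R$ for every $R>0$, where $B_R$ is the open ball of radius $R$ centred at $0$; $p\mapsto H_i(x,p)$ is convex for every $x$; and $\alpha(|p|)\le H_i(x,p)\le\beta(|p|)$ for all $x,p$, for some functions $\alpha,\beta:[0,\infty)\to\mathbb R$ with $\alpha(h)/h\to+\infty$ and $\beta(h)/h\to+\infty$ as $h\to+\infty$. Let $L_i(x,q)=\sup_{p}\{\langle p,q\rangle-H_i(x,p)\}$ be the associated Lagrangians. Let $B=(b_{ij})$ be a real $m\times m$ matrix with $b_{ij}\le 0$ for $j\ne i$ and $\sum_j b_{ij}=0$ for every $i$. Let $\Omega$ be the space of càdlàg paths $\omega:[0,\infty)\to\{1,\dots,m\}$, with the $\sigma$-algebra generated by the evaluations $\omega\mapsto\omega(t)$, and let $\mathbb P$ be a probability measure on $\Omega$ under which $(\omega(t))_{t\ge0}$ is a Markov chain with generator matrix $-B$, that is, $$\mathbb P\big(\omega(t_k)=i_k\,\big|\,\omega(t_1)=i_1,\dots,\omega(t_{k-1})=i_{k-1}\big)=\big(e^{-B(t_k-t_{k-1})}\big)_{i_{k-1}i_k}$$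 for all $k\ge2$, all times $0\le t_1<\dots<t_k$ and all states such that the conditioning event has positive probability. Assume $\mathbb P(\omega(0)=i)>0$ for every $i$, let $\mathbb P_i$ be $\mathbb P$ conditioned to $\{\omega(0)=i\}$, and let $\mathbb E_i$ be the expectation with respect to $\mathbb P_i$. A (deterministic) curve is a locally absolutely continuous map $\gamma:[0,\infty)\to\mathbb R^N$. An admissible curve is a random variable $\gamma$ on $\Omega$ with values in $C([0,\infty);\mathbb R^N)$ (with the Borel $\sigma$-algebra of locally uniform convergence) that is locally absolutely continuous in $t$ uniformly in $\omega\in\Omega$ and nonanticipating: if $\omega_1=\omega_2$ on $[0,t]$, then $\gamma(\cdot,\omega_1)=\gamma(\cdot,\omega_2)$ on $[0,t]$. For $\mathbf u^0:\mathbb R^N\to\mathbb R^m$, $t\ge0$, $x\in\mathbb R^N$ and $i\in\{1,\dots,m\}$, set $$\big(\mathcal S(t)\mathbf u^0\big)_i(x)=\inf_{\gamma}\ \mathbb E_i\Big[u^0_{\omega(t)}\big(\gamma(t,\omega)\big)+\int_0^tL_{\omega(s)}\big(\gamma(s,\omega),-\dot\gamma(s,\omega)\big)\,ds\Big],$$ the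 infimum being over all admissible curves with $\gamma(0,\omega)=x$ for every $\omega$; action integrals and their expectations take values in $(-\infty,+\infty]$. If $\mathbf u^0$ is bounded and continuous, then $\mathcal S(t)\mathbf u^0(x)$ is finite for all $(t,x)\in[0,\infty)\times\mathbb R^N$, and $\mathbf u(t,x):=\mathcal S(t)\mathbf u^0(x)$ satisfies the sub-optimality principle: for all $t_0,h\ge0$, all $i\in\{1,\dots,m\}$ and every deterministic curve $\gamma$, $$u_i\big(t_0+h,\gamma(0)\big)-\mathbb E_i\big[u_{\omega(h)}\big(t_0,\gamma(h)\big)\big]\le\mathbb E_i\Big[\int_0^hL_{\omega(s)}\big(\gamma(s),-\dot\gamma(s)\big)\,ds\Big].$$ -/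

import Mathlib

open MeasureTheory ProbabilityTheory Set Filter Topology
open scoped NNReal ENNReal

namespace RandomLaxOleinik

/-- `ℝ^N` with the Euclidean norm. -/
abbrev Space (N : ℕ) : Type := EuclideanSpace ℝ (Fin N)

section Hamiltonians

/-- Superlinear growth at infinity of a function on the half line. -/
def Superlinear (α : ℝ≥0 → ℝ) : Prop :=
  Tendsto (fun h : ℝ≥0 => α h / (h : ℝ)) atTop atTop

/-- The standing assumptions on a single Hamiltonian `H(x,p)`. -/
structure IsHamiltonian {N : ℕ} (H : Space N → Space N → ℝ) : Prop where
  uniformContinuousOn : ∀ R : ℝ, 0 < R →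
    UniformContinuousOn (fun z : Space N × Space N => H z.1 z.2) (univ ×ˢ Metric.ball 0 R)
  convex : ∀ x : Space N, ConvexOn ℝ univ (H x)
  superlinear : ∃ α β : ℝ≥0 → ℝ, Superlinear α ∧ Superlinear β ∧
    ∀ x p : Space N, α ‖p‖₊ ≤ H x p ∧ H x p ≤ β ‖p‖₊

/-- The Lagrangian (Fenchel transform) `L(x,q) = sup_p (⟨p,q⟩ - H(x,p))`. -/
noncomputable def lagrangian {N : ℕ} (H : Space N → Space N → ℝ) (x q : Space N) : ℝ :=
  ⨆ p : Space N, (inner ℝ p q - H x p)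

/-- Coupling matrices: nonpositive off-diagonal entries, rows summing to zero. -/
structure IsCoupling {m : ℕ} (B : Matrix (Fin m) (Fin m) ℝ) : Prop where
  nonpos_off_diag : ∀ i j, j ≠ i → B i j ≤ 0
  row_sum : ∀ i, ∑ j, B i j = 0

end Hamiltonians

section RandomFrame

/-- Càdlàg paths `[0,∞) → {1,…,m}` (discrete topology on the target). -/
def IsCadlag {m : ℕ} (ω : ℝ≥0 → Fin m) : Prop :=
  ∀ t : ℝ≥0, ContinuousWithinAt ω (Ici t) t ∧ ∃ l : Fin m, Tendsto ω (𝓝[<] t) (𝓝 l)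

/-- The sample space of càdlàg paths.  Its σ-algebra is the one generated by the evaluations
`ω ↦ ω t`, equivalently by the cylinders. -/
def Path (m : ℕ) : Type := {ω : ℝ≥0 → Fin m // IsCadlag ω}

instance (m : ℕ) : CoeFun (Path m) (fun _ => ℝ≥0 → Fin m) := ⟨Subtype.val⟩

instance (m : ℕ) : MeasurableSpace (Path m) :=
  ⨆ t : ℝ≥0, MeasurableSpace.comap (fun ω : Path m => ω t) ⊤

/-- The cylinder of the paths taking the value `i j` at time `t j` for every `j`. -/
def cylinder {m n : ℕ} (t : Fin n → ℝ≥0) (i : Fin n → Fin m) : Set (Path m) :=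
  {ω | ∀ j, ω (t j) = i j}

/-- Under `P` the coordinate process is a Markov chain with generator matrix `-B`: for all times
`0 ≤ t₀ < ⋯ < tₙ < tₙ₊₁`, conditionally on `ω(t₀) = i₀, …, ω(tₙ) = iₙ` (if this event is not
null), the probability of `ω(tₙ₊₁) = iₙ₊₁` is the entry `(iₙ, iₙ₊₁)` of
`exp (-(tₙ₊₁ - tₙ) B)`. -/
def IsMarkovChain {m : ℕ} (B : Matrix (Fin m) (Fin m) ℝ) (P : Measure (Path m)) : Prop :=
  ∀ (n : ℕ) (t : Fin (n + 2) → ℝ≥0) (i : Fin (n + 2) → Fin m), StrictMono t →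
    P (cylinder (fun j : Fin (n + 1) => t j.castSucc) (fun j => i j.castSucc)) ≠ 0 →
    P[|cylinder (fun j : Fin (n + 1) => t j.castSucc) (fun j => i j.castSucc)]
        {ω : Path m | ω (t (Fin.last (n + 1))) = i (Fin.last (n + 1))} =
      ENNReal.ofReal
        (NormedSpace.exp
          (-((t (Fin.last (n + 1)) : ℝ) - (t (Fin.last n).castSucc : ℝ)) • B)
          (i (Fin.last n).castSucc) (i (Fin.last (n + 1))))

/-- `P` conditioned to the event that the path starts at `i`. -/
noncomputable def startingAt {m : ℕ} (P : Measure (Path m)) (i : Fin m) : Measure (Path m) :=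
  P[|{ω : Path m | ω 0 = i}]

end RandomFrame

section Curves

/-- Local absolute continuity of a family of curves on `[0,∞)`, uniformly in the parameter. -/
def EquiLocallyAC {ι : Type*} {N : ℕ} (γ : ι → ℝ≥0 → Space N) : Prop :=
  ∀ (T : ℝ≥0) (ε : ℝ), 0 < ε → ∃ δ : ℝ, 0 < δ ∧
    ∀ (n : ℕ) (a b : Fin n → ℝ≥0), (∀ j, a j ≤ b j ∧ b j ≤ T) →
      (Pairwise fun j k => Disjoint (Ioo (a j) (b j)) (Ioo (a k) (b k))) →
      ∑ j, ((b j : ℝ) - (a j : ℝ)) < δ →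
      ∀ ω : ι, ∑ j, ‖γ ω (b j) - γ ω (a j)‖ < ε

/-- A (deterministic) curve: a locally absolutely continuous map on `[0,∞)`. -/
def IsCurve {N : ℕ} (γ : ℝ≥0 → Space N) : Prop :=
  ∀ T : ℝ≥0, AbsolutelyContinuousOnInterval (fun r : ℝ => γ r.toNNReal) 0 T

/-- Admissible curves: random variables with values in `C([0,∞); ℝ^N)` (with the Borel σ-algebra
of the topology of local uniform convergence) which are locally absolutely continuous uniformly
in `ω` and nonanticipating. -/
structure IsAdmissible {m N : ℕ} (γ : Path m → C(ℝ≥0, Space N)) : Prop where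
  measurable : Measurable[inferInstance, borel C(ℝ≥0, Space N)] γ
  equiLocallyAC : EquiLocallyAC fun ω t => γ ω t
  nonanticipating : ∀ (t : ℝ≥0) (ω₁ ω₂ : Path m), (∀ s ≤ t, ω₁ s = ω₂ s) →
    ∀ s ≤ t, γ ω₁ s = γ ω₂ s

/-- Time derivative of a curve on `[0,∞)` (used at times `s > 0` only). -/
noncomputable def velocity {N : ℕ} (γ : ℝ≥0 → Space N) (s : ℝ) : Space N :=
  deriv (fun r : ℝ => γ r.toNNReal) s

end Curves

section LaxOleinik

/-- Integral of an extended-real function, as the integral of the positive part minus the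
integral of the negative part.  (It is only used for functions whose negative part has finite
integral, so it takes values in `(-∞, +∞]`.) -/
noncomputable def eintegral {X : Type*} [MeasurableSpace X] (μ : Measure X) (f : X → EReal) :
    EReal :=
  ((∫⁻ x, (f x).toENNReal ∂μ : ℝ≥0∞) : EReal) - ((∫⁻ x, (-f x).toENNReal ∂μ : ℝ≥0∞) : EReal)

/-- The action `∫₀ᵗ L_{ω(s)}(γ(s), -γ'(s)) ds` in `(-∞, +∞]`. -/
noncomputable def action {m N : ℕ} (H : Fin m → Space N → Space N → ℝ) (t : ℝ≥0) (ω : Path m)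
    (γ : ℝ≥0 → Space N) : EReal :=
  eintegral (volume.restrict (Ioc (0 : ℝ) t)) fun s =>
    ((lagrangian (H (ω s.toNNReal)) (γ s.toNNReal) (-velocity γ s) : ℝ) : EReal)

/-- The random Lax–Oleinik formula
`inf_γ E_i [u⁰_{ω(t)}(γ(t,ω)) + ∫₀ᵗ L_{ω(s)}(γ(s,ω), -γ'(s,ω)) ds]`, the infimum being taken over
the admissible curves starting at `x`, as an extended real number. -/
noncomputable def laxOleinikE {m N : ℕ} (H : Fin m → Space N → Space N → ℝ) (P : Measure (Path m))
    (u₀ : Space N → Fin m → ℝ) (t : ℝ≥0) (x : Space N) (i : Fin m) : EReal :=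
  ⨅ γ ∈ {γ : Path m → C(ℝ≥0, Space N) | IsAdmissible γ ∧ ∀ ω, γ ω 0 = x},
    eintegral (startingAt P i) fun ω =>
      ((u₀ (γ ω t) (ω t) : ℝ) : EReal) + action H t ω (γ ω)

/-- The value function `(t,x) ↦ S(t)u⁰(x)`. -/
noncomputable def laxOleinik {m N : ℕ} (H : Fin m → Space N → Space N → ℝ) (P : Measure (Path m))
    (u₀ : Space N → Fin m → ℝ) (t : ℝ≥0) (x : Space N) (i : Fin m) : ℝ :=
  (laxOleinikE H P u₀ t x i).toReal

/-- The sub-optimality principle for `u : [0,∞) × ℝ^N → ℝ^m`. -/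
def SubOptimality {m N : ℕ} (H : Fin m → Space N → Space N → ℝ) (P : Measure (Path m))
    (u : ℝ≥0 → Space N → Fin m → ℝ) : Prop :=
  ∀ (t₀ h : ℝ≥0) (i : Fin m) (γ : ℝ≥0 → Space N), IsCurve γ →
    ((u (t₀ + h) (γ 0) i - ∫ ω, u t₀ (γ h) (ω h) ∂(startingAt P i) : ℝ) : EReal) ≤
      eintegral (startingAt P i) fun ω => action H h ω γ

end LaxOleinik

end RandomLaxOleinik

/-! Finiteness: testing the supremum with `p = 0` bounds all Lagrangians below by one constant, so
every cost is at least `-(C + c * t)`. Superlinearity and convexity bound `L(x, 0)` above uniformly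
in `x`, so constant curves have bounded cost.

Sub-optimality is one half of dynamic programming. Follow the deterministic curve `γ` up to time
`h`; if the chain is then in state `j`, continue with an `ε`-optimal admissible curve for `(γ h,
j)`, driven by the path seen from time `h` on. There are finitely many states, so finitely many
curves are chosen and no measurable selection arises. The result is a competitor for the problem
with horizon `h + t` (`isAdmissible_concat`), and its action is the sum of the two actions
(`action_concat`).

By the Markov property, the shifted path has under `P_i` the law `∑ j, P_i(ω h = j) • P_j`
(`IsMarkovChain.map_shift_startingAt`). Hence the expected remaining cost is at most the mean of
`u_{ω(h)}(t, γ h)` plus `ε` (`eintegral_shift_le`). That law is identified through its transitions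
and initial distribution, which determine all finite-dimensional marginals. -/

namespace RandomLaxOleinik

/-! ### Integrals of extended-real functions bounded below -/

section ExtendedIntegral

variable {X : Type*} [MeasurableSpace X]

/-- A subtraction-free form of `z = z⁺ - z⁻`, so that it can be integrated in `ℝ≥0∞` even where `z =
⊤`. -/
theorem toENNReal_add_coe_add_toENNReal_neg {z : EReal} {c : ℝ≥0} (hz : -((c : ℝ) : EReal) ≤ z) :
    (z + ((c : ℝ) : EReal)).toENNReal + (-z).toENNReal = z.toENNReal + c := by
  induction z with
  | bot =>
    rw [le_bot_iff, ← EReal.coe_neg] at hz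
    exact absurd hz (EReal.coe_ne_bot _)
  | top => simp
  | coe r =>
    have hr : -(c : ℝ) ≤ r := by exact_mod_cast hz
    rw [← EReal.coe_add, ← EReal.coe_neg]
    simp only [EReal.real_coe_toENNReal]
    rw [← ENNReal.ofReal_coe_nnreal (p := c)]
    rcases le_total 0 r with h | h
    · rw [ENNReal.ofReal_of_nonpos (neg_nonpos.2 h), add_zero,
        ENNReal.ofReal_add h c.coe_nonneg]
    · rw [ENNReal.ofReal_of_nonpos h, zero_add,
        ← ENNReal.ofReal_add (by linarith) (by linarith)]
      congr 1; ring

theorem lintegral_toENNReal_neg_le (μ : Measure X) {f : X → EReal} {c : ℝ≥0}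
    (hfc : ∀ x, -((c : ℝ) : EReal) ≤ f x) :
    ∫⁻ x, (-f x).toENNReal ∂μ ≤ c * μ univ := by
  rw [← lintegral_const]
  refine lintegral_mono fun x => ?_
  have h := EReal.toENNReal_le_toENNReal (EReal.neg_le_of_neg_le (hfc x))
  simpa using h

theorem lintegral_toENNReal_neg_ne_top (μ : Measure X) [IsFiniteMeasure μ] {f : X → EReal}
    {c : ℝ≥0} (hfc : ∀ x, -((c : ℝ) : EReal) ≤ f x) :
    ∫⁻ x, (-f x).toENNReal ∂μ ≠ ⊤ :=
  ((lintegral_toENNReal_neg_le μ hfc).trans_lt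
    (ENNReal.mul_lt_top ENNReal.coe_lt_top (measure_lt_top μ _))).ne

theorem coe_ennreal_add_sub_coe_ennreal_add {a b c d : ℝ≥0∞} (hb : b ≠ ⊤) :
    ((a + c : ℝ≥0∞) : EReal) - ((b + d : ℝ≥0∞) : EReal) =
      ((a : EReal) - (b : EReal)) + ((c : EReal) - (d : EReal)) := by
  have hb' : (b : EReal) ≠ ⊤ := by simpa using hb
  have hb'' : (b : EReal) ≠ ⊥ := EReal.coe_ennreal_ne_bot b
  rw [EReal.coe_ennreal_add, EReal.coe_ennreal_add, sub_eq_add_neg, sub_eq_add_neg, sub_eq_add_neg,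
    EReal.neg_add (Or.inl hb'') (Or.inl hb'), sub_eq_add_neg, add_add_add_comm]

/-- Trades the difference of two integrals for one `lintegral` minus a finite constant; additivity
and changes of measure then reduce to those of `lintegral`. -/
theorem eintegral_eq_lintegral_sub (μ : Measure X) [IsFiniteMeasure μ] {f : X → EReal}
    (hf : Measurable f) {c : ℝ≥0} (hfc : ∀ x, -((c : ℝ) : EReal) ≤ f x) :
    eintegral μ f = ((∫⁻ x, (f x + ((c : ℝ) : EReal)).toENNReal ∂μ : ℝ≥0∞) : EReal) -
      ((c * μ univ : ℝ≥0∞) : EReal) := by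
  have hN := lintegral_toENNReal_neg_ne_top μ hfc
  have hC : (c : ℝ≥0∞) * μ univ ≠ ⊤ := ENNReal.mul_ne_top ENNReal.coe_ne_top (measure_ne_top μ _)
  have hn : Measurable fun x => -f x := hf.neg
  have key : ∫⁻ x, (f x + ((c : ℝ) : EReal)).toENNReal ∂μ + ∫⁻ x, (-f x).toENNReal ∂μ =
      ∫⁻ x, (f x).toENNReal ∂μ + c * μ univ := by
    rw [← lintegral_const, ← lintegral_add_right _ hn.ereal_toENNReal,
      ← lintegral_add_right _ measurable_const]
    exact lintegral_congr fun x => toENNReal_add_coe_add_toENNReal_neg (hfc x)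
  unfold eintegral
  set a := ∫⁻ x, (f x + ((c : ℝ) : EReal)).toENNReal ∂μ
  set n := ∫⁻ x, (-f x).toENNReal ∂μ
  set p := ∫⁻ x, (f x).toENNReal ∂μ
  set k := (c : ℝ≥0∞) * μ univ
  have h1 := coe_ennreal_add_sub_coe_ennreal_add (a := a) (b := k) (c := n) (d := n) hC
  have h2 := coe_ennreal_add_sub_coe_ennreal_add (a := p) (b := n) (c := k) (d := k) hN
  rw [EReal.sub_self (by simpa using hN) (EReal.coe_ennreal_ne_bot n), add_zero] at h1
  rw [EReal.sub_self (by simpa using hC) (EReal.coe_ennreal_ne_bot k), add_zero] at h2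
  rw [← h1, ← h2, key, add_comm n k]

theorem le_eintegral (μ : Measure X) {f : X → EReal} {c : ℝ≥0}
    (hfc : ∀ x, -((c : ℝ) : EReal) ≤ f x) :
    -((c * μ univ : ℝ≥0∞) : EReal) ≤ eintegral μ f := by
  unfold eintegral
  rw [sub_eq_add_neg]
  refine le_add_of_nonneg_of_le (EReal.coe_ennreal_nonneg _) (EReal.neg_le_neg_iff.2 ?_)
  exact_mod_cast lintegral_toENNReal_neg_le μ hfc

theorem eintegral_le (μ : Measure X) {f : X → EReal} {c : ℝ≥0}
    (hfc : ∀ x, f x ≤ ((c : ℝ) : EReal)) :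
    eintegral μ f ≤ ((c * μ univ : ℝ≥0∞) : EReal) := by
  unfold eintegral
  refine (EReal.sub_le_sub le_rfl (EReal.coe_ennreal_nonneg _)).trans ?_
  rw [sub_zero]
  have : ∫⁻ x, (f x).toENNReal ∂μ ≤ c * μ univ := by
    rw [← lintegral_const]
    refine lintegral_mono fun x => ?_
    simpa using EReal.toENNReal_le_toENNReal (hfc x)
  exact_mod_cast this

theorem eintegral_add (μ : Measure X) [IsFiniteMeasure μ] {f g : X → EReal}
    (hf : Measurable f) (hg : Measurable g) {c d : ℝ≥0}
    (hfc : ∀ x, -((c : ℝ) : EReal) ≤ f x) (hgd : ∀ x, -((d : ℝ) : EReal) ≤ g x) :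
    eintegral μ (fun x => f x + g x) = eintegral μ f + eintegral μ g := by
  have hfin (c : ℝ≥0) : (c : ℝ≥0∞) * μ univ ≠ ⊤ :=
    ENNReal.mul_ne_top ENNReal.coe_ne_top (measure_ne_top μ _)
  have hshift {z : EReal} {c : ℝ≥0} (h : -((c : ℝ) : EReal) ≤ z) :
      0 ≤ z + ((c : ℝ) : EReal) := by
    have := add_le_add_left h ((c : ℝ) : EReal)
    rwa [← EReal.coe_neg, ← EReal.coe_add, neg_add_cancel, EReal.coe_zero] at this
  have hcoe : (((c + d : ℝ≥0) : ℝ) : EReal) = ((c : ℝ) : EReal) + ((d : ℝ) : EReal) := by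
    push_cast; rfl
  have hsum : ∀ x, -(((c + d : ℝ≥0) : ℝ) : EReal) ≤ f x + g x := fun x => by
    have := add_le_add (hfc x) (hgd x)
    rwa [← EReal.coe_neg, ← EReal.coe_neg, ← EReal.coe_add, ← neg_add, EReal.coe_neg,
      ← NNReal.coe_add] at this
  have hfg : Measurable fun x => f x + g x := hf.add hg
  have hfc' : Measurable fun x => f x + ((c : ℝ) : EReal) := hf.add measurable_const
  rw [eintegral_eq_lintegral_sub μ hfg hsum, eintegral_eq_lintegral_sub μ hf hfc,
    eintegral_eq_lintegral_sub μ hg hgd, ← coe_ennreal_add_sub_coe_ennreal_add (hfin c),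
    ← lintegral_add_left hfc'.ereal_toENNReal, ENNReal.coe_add, add_mul]
  congr 2
  refine lintegral_congr fun x => ?_
  rw [← EReal.toENNReal_add (hshift (hfc x)) (hshift (hgd x)), hcoe, add_add_add_comm]

theorem eintegral_add_measure {μ ν : Measure X} {f : X → EReal}
    (hμ : ∫⁻ x, (-f x).toENNReal ∂μ ≠ ⊤) :
    eintegral (μ + ν) f = eintegral μ f + eintegral ν f := by
  unfold eintegral
  rw [lintegral_add_measure, lintegral_add_measure, coe_ennreal_add_sub_coe_ennreal_add hμ]

theorem eintegral_congr_ae {μ : Measure X} {f g : X → EReal} (h : f =ᵐ[μ] g) :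
    eintegral μ f = eintegral μ g := by
  have h₁ : ∫⁻ x, (f x).toENNReal ∂μ = ∫⁻ x, (g x).toENNReal ∂μ :=
    lintegral_congr_ae (h.mono fun x hx => by simp only [hx])
  have h₂ : ∫⁻ x, (-f x).toENNReal ∂μ = ∫⁻ x, (-g x).toENNReal ∂μ :=
    lintegral_congr_ae (h.mono fun x hx => by simp only [hx])
  rw [eintegral, h₁, h₂, eintegral]

theorem measurable_eintegral_prod_right {Y : Type*} [MeasurableSpace Y] {ν : Measure Y}
    [SFinite ν] {f : X → Y → EReal} (hf : Measurable (Function.uncurry f)) :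
    Measurable fun x => eintegral ν (f x) := by
  unfold eintegral
  have h1 : Measurable fun x => ∫⁻ y, (f x y).toENNReal ∂ν :=
    (hf.ereal_toENNReal).lintegral_prod_right'
  have h2 : Measurable fun x => ∫⁻ y, (-f x y).toENNReal ∂ν :=
    (hf.neg.ereal_toENNReal).lintegral_prod_right'
  simp_rw [sub_eq_add_neg]
  exact h1.coe_ereal_ennreal.add h2.coe_ereal_ennreal.neg

end ExtendedIntegral

/-! ### Uniform bounds and measurability of the Lagrangian -/

section Lagrangian

variable {N : ℕ} {H : Space N → Space N → ℝ}

/-- The function `α` may be unbounded below on bounded sets, so convexity is needed: `0` is a convex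
combination of `p` and the opposite point `p'` of norm `R`. As `H x 0` is bounded below and `H x p'`
above, `H x p` cannot be very negative. -/
theorem IsHamiltonian.exists_le_of_norm_lt (hH : IsHamiltonian H) {R : ℝ} (hR : 0 < R) :
    ∃ C : ℝ, ∀ x p : Space N, ‖p‖ < R → C ≤ H x p := by
  obtain ⟨α, β, -, -, hab⟩ := hH.superlinear
  refine ⟨-(2 * (|α 0| + |β ⟨R, hR.le⟩|)), fun x p hp => ?_⟩
  have h0 : α 0 ≤ H x 0 := by simpa using (hab x 0).1
  have e1 := neg_abs_le (α 0)
  have e2 := le_abs_self (β ⟨R, hR.le⟩)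
  have e3 := abs_nonneg (α 0)
  have e4 := abs_nonneg (β ⟨R, hR.le⟩)
  rcases eq_or_ne p 0 with rfl | hp0
  · linarith
  have hpos : 0 < ‖p‖ := norm_pos_iff.2 hp0
  set p' : Space N := -(R / ‖p‖) • p
  have hn : ‖p'‖₊ = ⟨R, hR.le⟩ := by
    ext
    simp only [p', coe_nnnorm, norm_smul, norm_neg, Real.norm_eq_abs, abs_div, abs_norm]
    rw [abs_of_pos hR]
    change R / ‖p‖ * ‖p‖ = R
    field_simp
  have hb : H x p' ≤ β ⟨R, hR.le⟩ := hn ▸ (hab x p').2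
  have hs : 0 < R + ‖p‖ := by positivity
  have hc := (hH.convex x).2 (mem_univ p) (mem_univ p') 
    (show 0 ≤ R / (R + ‖p‖) by positivity) (show 0 ≤ ‖p‖ / (R + ‖p‖) by positivity)
    (by field_simp)
  have hz : (R / (R + ‖p‖)) • p + (‖p‖ / (R + ‖p‖)) • p' = 0 := by
    simp only [p', smul_smul, ← add_smul]
    have : R / (R + ‖p‖) + ‖p‖ / (R + ‖p‖) * -(R / ‖p‖) = 0 := by field_simp; ring
    rw [this, zero_smul]
  rw [hz, smul_eq_mul, smul_eq_mul] at hc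
  have hd : (R + ‖p‖) * H x 0 ≤ R * H x p + ‖p‖ * H x p' := by
    have := mul_le_mul_of_nonneg_left hc hs.le
    field_simp at this
    linarith
  have h5 : ‖p‖ * H x p' ≤ R * |β ⟨R, hR.le⟩| :=
    (mul_le_mul_of_nonneg_left (hb.trans e2) hpos.le).trans
      (mul_le_mul_of_nonneg_right hp.le e4)
  have h6 : (R + ‖p‖) * |α 0| ≤ 2 * R * |α 0| :=
    mul_le_mul_of_nonneg_right (by linarith) e3
  have h7 : -((R + ‖p‖) * |α 0|) ≤ (R + ‖p‖) * H x 0 := by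
    rw [← mul_neg]; exact mul_le_mul_of_nonneg_left (e1.trans h0) hs.le
  have : R * (-(2 * (|α 0| + |β ⟨R, hR.le⟩|))) ≤ R * H x p := by
    have := mul_nonneg hR.le e4
    nlinarith
  exact le_of_mul_le_mul_left this hR

/-- For large `p`, `α ‖p‖ ≥ M * ‖p‖` makes the expression nonpositive; on the remaining ball the
convexity bound applies. The two entries of the `max` are these two cases. -/
theorem IsHamiltonian.exists_inner_sub_le (hH : IsHamiltonian H) {M : ℝ} (hM : 0 ≤ M) :
    ∃ C : ℝ, ∀ x q p : Space N, ‖q‖ ≤ M → inner ℝ p q - H x p ≤ C := by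
  obtain ⟨α, β, hα, -, hab⟩ := hH.superlinear
  obtain ⟨R, hR⟩ := eventually_atTop.1 (hα.eventually (eventually_ge_atTop M))
  have hR1 : (0 : ℝ) < R + 1 := by positivity
  obtain ⟨C, hC⟩ := hH.exists_le_of_norm_lt hR1
  refine ⟨max 0 (M * (R + 1) - C), fun x q p hq => ?_⟩
  have hin : inner ℝ p q ≤ ‖p‖ * M :=
    (real_inner_le_norm p q).trans (mul_le_mul_of_nonneg_left hq (norm_nonneg p))
  rcases lt_or_ge ‖p‖ (R + 1) with hp | hp
  · refine le_max_of_le_right ?_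
    have := hC x p hp
    have h2 := mul_le_mul_of_nonneg_right hp.le hM
    linarith
  · refine le_max_of_le_left ?_
    have hp0 : 0 < ‖p‖ := hR1.trans_le hp
    have h1 := hR ‖p‖₊ (by rw [← NNReal.coe_le_coe, coe_nnnorm]; linarith)
    rw [coe_nnnorm, le_div_iff₀ hp0] at h1
    have := (hab x p).1
    linarith

theorem IsHamiltonian.bddAbove (hH : IsHamiltonian H) (x q : Space N) :
    BddAbove (range fun p : Space N => inner ℝ p q - H x p) := by
  obtain ⟨C, hC⟩ := hH.exists_inner_sub_le (norm_nonneg q)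
  exact ⟨C, by rintro _ ⟨p, rfl⟩; exact hC x q p le_rfl⟩

theorem IsHamiltonian.exists_neg_le_lagrangian (hH : IsHamiltonian H) :
    ∃ c : ℝ≥0, ∀ x q : Space N, -(c : ℝ) ≤ lagrangian H x q := by
  obtain ⟨α, β, -, -, hab⟩ := hH.superlinear
  refine ⟨⟨|β 0|, abs_nonneg _⟩, fun x q => ?_⟩
  have h := le_ciSup (hH.bddAbove x q) 0
  have h0 : H x 0 ≤ β 0 := by simpa using (hab x 0).2
  rw [inner_zero_left] at h
  have e := le_abs_self (β 0)
  change -|β 0| ≤ _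
  unfold lagrangian
  linarith

theorem IsHamiltonian.exists_lagrangian_zero_le (hH : IsHamiltonian H) :
    ∃ c : ℝ≥0, ∀ x : Space N, lagrangian H x 0 ≤ c := by
  obtain ⟨C, hC⟩ := hH.exists_inner_sub_le le_rfl
  refine ⟨C.toNNReal, fun x => (ciSup_le fun p => hC x 0 p (by simp)).trans ?_⟩
  exact Real.le_coe_toNNReal C

theorem IsHamiltonian.continuous_left (hH : IsHamiltonian H) (p : Space N) :
    Continuous fun x => H x p := by
  have h := (hH.uniformContinuousOn (‖p‖ + 1) (by positivity)).continuousOn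
  have := h.comp_continuous (f := fun x : Space N => (x, p)) (by fun_prop) (fun x => by
    simp)
  exact this

/-- The supremum is uncountable, so measurability comes from lower semicontinuity, a supremum of
continuous functions of `(x, q)` being lower semicontinuous. -/
theorem IsHamiltonian.measurable_lagrangian (hH : IsHamiltonian H) :
    Measurable fun z : Space N × Space N => lagrangian H z.1 z.2 := by
  refine LowerSemicontinuous.measurable ?_
  refine lowerSemicontinuous_ciSup (fun z => hH.bddAbove z.1 z.2) fun p => ?_
  refine Continuous.lowerSemicontinuous ?_
  have := (hH.continuous_left p).comp (continuous_fst (X := Space N) (Y := Space N))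
  exact (continuous_const.inner continuous_snd).sub this

end Lagrangian

/-! ### Absolute continuity, uniform in a parameter -/

section AbsoluteContinuity

variable {N : ℕ} {ι : Type*}

theorem IsCurve.equiLocallyAC {γ : ℝ≥0 → Space N} (hγ : IsCurve γ) :
    EquiLocallyAC fun _ : ι => γ := by
  intro T ε hε
  obtain ⟨δ, hδ, h⟩ := (absolutelyContinuousOnInterval_iff _ _ _).1 (hγ T) ε hε
  refine ⟨δ, hδ, fun n a b hab hdis hsum _ => ?_⟩
  -- Only indices below `n` are ever inspected; `(0, 0)` is a filler.
  set E : ℕ × (ℕ → ℝ × ℝ) :=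
    (n, fun k => if hk : k < n then ((a ⟨k, hk⟩ : ℝ), (b ⟨k, hk⟩ : ℝ)) else (0, 0))
  have hE : ∀ k : Fin n, E.2 k = ((a k : ℝ), (b k : ℝ)) := fun k => by simp [E]
  have hmem : E ∈ AbsolutelyContinuousOnInterval.disjWithin 0 (T : ℝ) := by
    constructor
    · intro k hk
      have hk' : k < n := Finset.mem_range.1 hk
      have := hE ⟨k, hk'⟩
      simp only at this
      rw [this, uIcc_of_le T.coe_nonneg]
      have h2 := hab ⟨k, hk'⟩
      exact ⟨⟨NNReal.coe_nonneg _, NNReal.coe_le_coe.2 (h2.1.trans h2.2)⟩,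
        ⟨NNReal.coe_nonneg _, NNReal.coe_le_coe.2 h2.2⟩⟩
    · intro j hj k hk hjk
      have hj' : j < n := by simpa [E] using hj
      have hk' : k < n := by simpa [E] using hk
      have e1 := hE ⟨j, hj'⟩
      have e2 := hE ⟨k, hk'⟩
      simp only at e1 e2
      have hd := hdis (i := ⟨j, hj'⟩) (j := ⟨k, hk'⟩) (by simpa using hjk)
      simp only [Function.onFun]
      -- Disjointness of half-open and of open intervals is the same inequality between the `min` of
      -- right ends and the `max` of left ends.
      rw [e1, e2, uIoc_of_le (NNReal.coe_le_coe.2 (hab _).1),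
        uIoc_of_le (NNReal.coe_le_coe.2 (hab _).1), Ioc_disjoint_Ioc]
      simp only [Set.Ioo_disjoint_Ioo] at hd
      exact_mod_cast hd
  have hlt := h E hmem
  have e : E.1 = n := rfl
  rw [e, Finset.sum_range, Finset.sum_range] at hlt
  simp only [hE, Real.toNNReal_coe] at hlt
  refine lt_of_eq_of_lt (Finset.sum_congr rfl fun j _ => ?_) (hlt (lt_of_eq_of_lt
    (Finset.sum_congr rfl fun j _ => ?_) hsum))
  · rw [dist_comm, dist_eq_norm]
  · rw [dist_comm, Real.dist_eq, abs_of_nonneg (sub_nonneg.2 (NNReal.coe_le_coe.2 (hab j).1))]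

theorem IsCurve.continuous {γ : ℝ≥0 → Space N} (hγ : IsCurve γ) : Continuous γ := by
  rw [continuous_iff_continuousAt]
  intro t
  have h := (hγ (t + 1)).continuousOn
  rw [uIcc_of_le (NNReal.coe_nonneg _)] at h
  have h1 : ContinuousWithinAt γ (Iic (t + 1)) t := by
    have := (h t ⟨t.coe_nonneg, by simp⟩).comp (f := fun s : ℝ≥0 => (s : ℝ)) (s := Iic (t + 1))
      (t := Icc 0 ((t + 1 : ℝ≥0) : ℝ)) (NNReal.continuous_coe.continuousWithinAt)
      (fun s hs => ⟨s.coe_nonneg, NNReal.coe_le_coe.2 hs⟩)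
    simpa [Function.comp_def] using this
  exact h1.continuousAt (Iic_mem_nhds (by simp))

theorem EquiLocallyAC.add {γ η : ι → ℝ≥0 → Space N} (hγ : EquiLocallyAC γ)
    (hη : EquiLocallyAC η) : EquiLocallyAC fun ω t => γ ω t + η ω t := by
  intro T ε hε
  obtain ⟨δ₁, h₁, H₁⟩ := hγ T (ε / 2) (half_pos hε)
  obtain ⟨δ₂, h₂, H₂⟩ := hη T (ε / 2) (half_pos hε)
  refine ⟨min δ₁ δ₂, lt_min h₁ h₂, fun n a b hab hdis hsum ω => ?_⟩
  have e₁ := H₁ n a b hab hdis (hsum.trans_le (min_le_left _ _)) ω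
  have e₂ := H₂ n a b hab hdis (hsum.trans_le (min_le_right _ _)) ω
  calc ∑ j, ‖γ ω (b j) + η ω (b j) - (γ ω (a j) + η ω (a j))‖
      ≤ ∑ j, (‖γ ω (b j) - γ ω (a j)‖ + ‖η ω (b j) - η ω (a j)‖) :=
        Finset.sum_le_sum fun j _ => by
          rw [add_sub_add_comm]; exact norm_add_le _ _
    _ < ε := by rw [Finset.sum_add_distrib]; linarith

theorem equiLocallyAC_const (c : Space N) : EquiLocallyAC fun (_ : ι) (_ : ℝ≥0) => c :=
  fun _ ε hε => ⟨1, one_pos, fun n a b _ _ _ _ => by simpa using hε⟩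

theorem EquiLocallyAC.comp_param {κ : Type*} {γ : ι → ℝ≥0 → Space N} (hγ : EquiLocallyAC γ)
    (f : κ → ι) : EquiLocallyAC fun k => γ (f k) := by
  intro T ε hε
  obtain ⟨δ, hδ, h⟩ := hγ T ε hε
  exact ⟨δ, hδ, fun n a b hab hdis hsum k => h n a b hab hdis hsum (f k)⟩

theorem EquiLocallyAC.of_finite {κ : Type*} [Finite κ] {γ : κ → ι → ℝ≥0 → Space N}
    (hγ : ∀ k, EquiLocallyAC (γ k)) : EquiLocallyAC fun p : κ × ι => γ p.1 p.2 := by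
  intro T ε hε
  have := Fintype.ofFinite κ
  choose δ hδ h using fun k => hγ k T ε hε
  obtain ⟨d, hd, hdk⟩ : ∃ d : ℝ, 0 < d ∧ ∀ k, d ≤ δ k := by
    rcases isEmpty_or_nonempty κ with hκ | hκ
    · exact ⟨1, one_pos, fun k => hκ.elim k⟩
    · obtain ⟨k, hk⟩ := Finite.exists_min δ
      exact ⟨δ k, hδ k, hk⟩
  exact ⟨d, hd, fun n a b hab hdis hsum p =>
    h p.1 n a b hab hdis (hsum.trans_le (hdk p.1)) p.2⟩

/-- Such a time change sends disjoint intervals to disjoint intervals that are no longer, so the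
same `δ` works. It is applied to `min · h` and to the truncated `· - h`. -/
theorem EquiLocallyAC.comp_time {γ : ι → ℝ≥0 → Space N} (hγ : EquiLocallyAC γ)
    {τ : ℝ≥0 → ℝ≥0} (hmono : Monotone τ) (hle : ∀ t, τ t ≤ t)
    (hlip : ∀ s t, s ≤ t → (τ t : ℝ) - τ s ≤ t - s) :
    EquiLocallyAC fun ω t => γ ω (τ t) := by
  intro T ε hε
  obtain ⟨δ, hδ, h⟩ := hγ T ε hε
  refine ⟨δ, hδ, fun n a b hab hdis hsum ω => ?_⟩
  refine h n (fun j => τ (a j)) (fun j => τ (b j))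
    (fun j => ⟨hmono (hab j).1, (hle _).trans (hab j).2⟩) (fun j k hjk => ?_) ?_ ω
  · have hd := hdis hjk
    simp only [Set.Ioo_disjoint_Ioo] at hd ⊢
    rw [← hmono.map_min, ← hmono.map_max]
    exact hmono hd
  · exact (Finset.sum_le_sum fun j _ => hlip _ _ (hab j).1).trans_lt hsum

end AbsoluteContinuity

/-! ### The path space and the time shift -/

section Paths

variable {m : ℕ}

theorem Path.measurable_eval (t : ℝ≥0) : Measurable fun ω : Path m => ω t :=
  measurable_iff_comap_le.2
    (le_iSup (fun t : ℝ≥0 => MeasurableSpace.comap (fun ω : Path m => ω t) ⊤) t)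

theorem Path.measurable_of_eval {X : Type*} [MeasurableSpace X] {f : X → Path m}
    (hf : ∀ t, Measurable fun x => f x t) : Measurable f := by
  refine measurable_iff_comap_le.2 ?_
  change MeasurableSpace.comap f (⨆ t : ℝ≥0, MeasurableSpace.comap (fun ω : Path m => ω t) ⊤) ≤ _
  rw [MeasurableSpace.comap_iSup]
  refine iSup_le fun t => ?_
  rw [MeasurableSpace.comap_comp]
  exact measurable_iff_comap_le.1 (hf t)

theorem Path.measurableSet_eval_eq (t : ℝ≥0) (i : Fin m) :
    MeasurableSet {ω : Path m | ω t = i} :=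
  Path.measurable_eval t (measurableSet_singleton i)

/-- The underlying map of a path. -/
def Path.toFun (ω : Path m) : ℝ≥0 → Fin m := ω.1

/-- Allows laws on paths to be compared on the product space, where finite-dimensional marginals
determine a finite measure. -/
theorem Path.measurableSpace_eq_comap :
    instMeasurableSpacePath m =
      MeasurableSpace.comap Path.toFun MeasurableSpace.pi := by
  change (⨆ t : ℝ≥0, MeasurableSpace.comap (fun ω : Path m => ω t) ⊤) = _
  rw [MeasurableSpace.pi, MeasurableSpace.comap_iSup]
  refine iSup_congr fun t => ?_
  rw [MeasurableSpace.comap_comp]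
  rfl

theorem Path.measurable_toFun : Measurable (Path.toFun (m := m)) :=
  measurable_pi_lambda _ Path.measurable_eval

/-- The paths seen from time `h` on. -/
def Path.shift (h : ℝ≥0) (ω : Path m) : Path m :=
  ⟨fun t => ω (h + t), fun t => by
    obtain ⟨h1, l, h2⟩ := ω.2 (h + t)
    refine ⟨h1.comp (t := Ici (h + t)) (by fun_prop) fun s hs => add_le_add_right (mem_Ici.1 hs) h,
      l, h2.comp ?_⟩
    refine tendsto_nhdsWithin_iff.2 ⟨?_, ?_⟩
    · exact ((continuous_const.add continuous_id).tendsto t).mono_left nhdsWithin_le_nhds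
    · filter_upwards [self_mem_nhdsWithin] with s hs
      exact add_lt_add_right (mem_Iio.1 hs) h⟩

@[simp]
theorem Path.shift_apply (h t : ℝ≥0) (ω : Path m) : ω.shift h t = ω (h + t) := rfl

theorem Path.measurable_shift (h : ℝ≥0) : Measurable (Path.shift h : Path m → Path m) :=
  Path.measurable_of_eval fun t => Path.measurable_eval (h + t)

end Paths

/-! ### The Markov property at a deterministic time -/

section Markov

variable {m : ℕ}

/-- The paths that agree with `f` at the times in `s`. -/
def agreeOn (s : Finset ℝ≥0) (f : ℝ≥0 → Fin m) : Set (Path m) := {ω | ∀ t ∈ s, ω t = f t}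

theorem measurableSet_agreeOn (s : Finset ℝ≥0) (f : ℝ≥0 → Fin m) :
    MeasurableSet (agreeOn s f) := by
  have : agreeOn s f = ⋂ t ∈ s, {ω : Path m | ω t = f t} := by
    ext ω; simp [agreeOn]
  rw [this]
  exact Finset.measurableSet_biInter s fun t _ => Path.measurableSet_eval_eq t (f t)

theorem agreeOn_insert (a : ℝ≥0) (s : Finset ℝ≥0) (f : ℝ≥0 → Fin m) :
    agreeOn (insert a s) f = agreeOn s f ∩ {ω | ω a = f a} := by
  ext ω
  simp only [agreeOn, Finset.mem_insert, forall_eq_or_imp, mem_ofPred_eq, mem_inter_iff]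
  exact and_comm

/-- One-step transitions of a time-homogeneous chain with transition kernel `K`, in terms of
finite sets of times; the initial law is unconstrained. -/
def HasTransitions (K : ℝ → Fin m → Fin m → ℝ≥0∞) (μ : Measure (Path m)) : Prop :=
  ∀ (s : Finset ℝ≥0) (a b : ℝ≥0) (f : ℝ≥0 → Fin m), b ∈ s → (∀ x ∈ s, x ≤ b) → b < a →
    μ (agreeOn (insert a s) f) = μ (agreeOn s f) * K ((a : ℝ) - b) (f b) (f a)

/-- The product form also holds on null events and is linear in the measure, so it passes to
restrictions, multiples, sums and shifts. -/
theorem IsMarkovChain.hasTransitions {B : Matrix (Fin m) (Fin m) ℝ} {P : Measure (Path m)}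
    [IsFiniteMeasure P] (hP : IsMarkovChain B P) :
    HasTransitions (fun r i j => ENNReal.ofReal (NormedSpace.exp (-r • B) i j)) P := by
  intro s a b f hb hmax hba
  rw [agreeOn_insert]
  by_cases h0 : P (agreeOn s f) = 0
  · rw [h0, zero_mul]
    exact measure_mono_null inter_subset_left h0
  obtain ⟨n, hn⟩ : ∃ n, s.card = n + 1 :=
    ⟨s.card - 1, (Nat.sub_add_cancel (Finset.card_pos.2 ⟨b, hb⟩)).symm⟩
  set e := s.orderEmbOfFin hn
  set t : Fin (n + 2) → ℝ≥0 := Fin.snoc e a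
  have htc : ∀ j : Fin (n + 1), t j.castSucc = e j := fun j => Fin.snoc_castSucc ..
  have htl : t (Fin.last (n + 1)) = a := Fin.snoc_last ..
  have hle : ∀ j, e j < a := fun j =>
    (hmax _ (Finset.orderEmbOfFin_mem s hn j)).trans_lt hba
  have hmono : StrictMono t := by
    intro j k hjk
    induction k using Fin.lastCases with
    | last =>
      induction j using Fin.lastCases with
      | last => exact absurd hjk (lt_irrefl _)
      | cast j => rw [htc, htl]; exact hle j
    | cast k =>
      induction j using Fin.lastCases with
      | last => exact absurd (hjk.trans (Fin.castSucc_lt_last k)) (lt_irrefl _)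
      | cast j =>
        rw [htc, htc]
        exact e.strictMono (Fin.castSucc_lt_castSucc_iff.1 hjk)
  have heb : e (Fin.last n) = b := by
    refine le_antisymm (hmax _ (Finset.orderEmbOfFin_mem s hn _)) ?_
    have : b ∈ Set.range e := by rw [Finset.range_orderEmbOfFin]; exact hb
    obtain ⟨k, hk⟩ := this
    rw [← hk]
    exact e.monotone (Fin.le_last k)
  have hcyl : cylinder (m := m) (fun j : Fin (n + 1) => t j.castSucc)
      (fun j => f (t j.castSucc)) = agreeOn s f := by
    ext ω
    simp only [cylinder, agreeOn, mem_ofPred_eq, htc]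
    constructor
    · intro h x hx
      have : x ∈ Set.range e := by rw [Finset.range_orderEmbOfFin]; exact hx
      obtain ⟨k, rfl⟩ := this
      exact h k
    · exact fun h j => h _ (Finset.orderEmbOfFin_mem s hn j)
  have key := hP n t (fun j => f (t j)) hmono (by rw [hcyl]; exact h0)
  rw [hcyl, htl, htc, heb] at key
  rw [← cond_mul_eq_inter (measurableSet_agreeOn s f), key, mul_comm]

variable {K : ℝ → Fin m → Fin m → ℝ≥0∞} {μ ν : Measure (Path m)}

/-- Fixing the initial state amounts to adding the time `0` to the finite set of times, unless `f 0`
contradicts it; then both sides vanish. -/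
theorem HasTransitions.restrict (h : HasTransitions K μ) (i : Fin m) :
    HasTransitions K (μ.restrict {ω | ω 0 = i}) := by
  intro s a b f hb hmax hba
  have key : ∀ u : Finset ℝ≥0, (0 ∈ u → f 0 = i) →
      agreeOn u f ∩ {ω | ω 0 = i} = agreeOn (insert 0 u) (Function.update f 0 i) := by
    intro u hu
    ext ω
    simp only [agreeOn, mem_inter_iff, mem_ofPred_eq, Finset.mem_insert, forall_eq_or_imp,
      Function.update_self]
    rw [and_comm]
    refine and_congr_right fun _ => forall₂_congr fun t ht => ?_
    rcases eq_or_ne t 0 with rfl | ht0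
    · rw [Function.update_self, hu ht]
    · rw [Function.update_of_ne ht0]
  have ha : a ≠ 0 := (pos_of_gt hba).ne'
  rw [Measure.restrict_apply (measurableSet_agreeOn _ _),
    Measure.restrict_apply (measurableSet_agreeOn _ _)]
  by_cases hs : 0 ∈ s → f 0 = i
  · rw [key s hs, key (insert a s) (fun h0 => by
      rcases Finset.mem_insert.1 h0 with h0 | h0
      · exact absurd h0.symm ha
      · exact hs h0), Finset.insert_comm, h (insert 0 s) a b _ (Finset.mem_insert_of_mem hb)
      (fun x hx => by
        rcases Finset.mem_insert.1 hx with rfl | hx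
        · exact zero_le
        · exact hmax x hx) hba, Function.update_of_ne ha]
    congr 2
    rcases eq_or_ne b 0 with rfl | hb0
    · rw [Function.update_self, hs hb]
    · rw [Function.update_of_ne hb0]
  · push Not at hs
    have hempty : ∀ u : Finset ℝ≥0, 0 ∈ u → agreeOn u f ∩ {ω | ω 0 = i} = ∅ := by
      intro u hu
      ext ω
      simp only [agreeOn, mem_inter_iff, mem_ofPred_eq, mem_empty_iff_false, iff_false, not_and]
      intro h1 h2
      exact hs.2 ((h1 0 hu).symm.trans h2)
    rw [hempty s hs.1, hempty _ (Finset.mem_insert_of_mem hs.1)]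
    simp

theorem HasTransitions.smul (h : HasTransitions K μ) (c : ℝ≥0∞) : HasTransitions K (c • μ) := by
  intro s a b f hb hmax hba
  simp only [Measure.smul_apply, smul_eq_mul]
  rw [h s a b f hb hmax hba, mul_assoc]

theorem HasTransitions.sum {ι : Type*} (S : Finset ι) {μ : ι → Measure (Path m)}
    (h : ∀ i, HasTransitions K (μ i)) : HasTransitions K (∑ i ∈ S, μ i) := by
  intro s a b f hb hmax hba
  simp only [Measure.coe_finsetSum, Finset.sum_apply]
  rw [Finset.sum_mul]
  exact Finset.sum_congr rfl fun i _ => h i s a b f hb hmax hba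

theorem HasTransitions.map_shift (h : HasTransitions K μ) (r : ℝ≥0) :
    HasTransitions K (μ.map (Path.shift r)) := by
  intro s a b f hb hmax hba
  have key : ∀ u : Finset ℝ≥0, Path.shift r ⁻¹' agreeOn u f =
      agreeOn (u.image (r + ·)) (fun t => f (t - r)) := by
    intro u
    ext ω
    simp [agreeOn]
  rw [Measure.map_apply (Path.measurable_shift r) (measurableSet_agreeOn _ _),
    Measure.map_apply (Path.measurable_shift r) (measurableSet_agreeOn _ _), key, key,
    Finset.image_insert, h _ (r + a) (r + b) _ (Finset.mem_image_of_mem _ hb) (fun x hx => by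
      obtain ⟨y, hy, rfl⟩ := Finset.mem_image.1 hx
      exact add_le_add_right (hmax y hy) r) (add_lt_add_right hba r)]
  simp

/-- Induction on the largest time. Time `0` is always kept in the set, so that the base case is the
initial law and every later step has a preceding time. -/
theorem HasTransitions.agreeOn_eq (hμ : HasTransitions K μ) (hν : HasTransitions K ν)
    (h0 : ∀ k, μ {ω | ω 0 = k} = ν {ω | ω 0 = k}) (s : Finset ℝ≥0) (f : ℝ≥0 → Fin m) :
    μ (agreeOn (insert 0 s) f) = ν (agreeOn (insert 0 s) f) := by
  have hbase : agreeOn (insert 0 ∅) f = {ω : Path m | ω 0 = f 0} := by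
    ext ω; simp [agreeOn]
  induction s using Finset.induction_on_max with
  | empty => rw [hbase, h0]
  | insert a s hs ih =>
    rcases eq_or_ne a 0 with rfl | ha
    · rwa [Finset.insert_idem]
    have hne : (insert 0 s).Nonempty := ⟨0, Finset.mem_insert_self 0 s⟩
    have hlt : (insert 0 s).max' hne < a := by
      rw [Finset.max'_lt_iff]
      intro x hx
      rcases Finset.mem_insert.1 hx with rfl | hx
      · exact pos_iff_ne_zero.2 ha
      · exact hs x hx
    rw [Finset.insert_comm,
      hμ _ a _ f (Finset.max'_mem _ hne) (fun x hx => Finset.le_max' _ x hx) hlt,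
      hν _ a _ f (Finset.max'_mem _ hne) (fun x hx => Finset.le_max' _ x hx) hlt, ih]

/-- The transition kernel and the initial law determine the law of the chain. -/
theorem HasTransitions.eq [IsFiniteMeasure μ] (hμ : HasTransitions K μ)
    (hν : HasTransitions K ν) (h0 : ∀ k, μ {ω | ω 0 = k} = ν {ω | ω 0 = k}) : μ = ν := by
  have hproj : ∀ I : Finset ℝ≥0, (ν.map Path.toFun).map I.restrict =
      (μ.map Path.toFun).map I.restrict := by
    intro I
    have hsub : I ⊆ insert 0 I := Finset.subset_insert 0 I
    have hJ : (ν.map Path.toFun).map (insert 0 I).restrict =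
        (μ.map Path.toFun).map (insert 0 I).restrict := by
      refine Measure.ext_of_singleton fun x => ?_
      have hmeas := Finset.measurable_restrict (X := fun _ : ℝ≥0 => Fin m) (insert 0 I)
      rw [Measure.map_apply hmeas (measurableSet_singleton x),
        Measure.map_apply hmeas (measurableSet_singleton x),
        Measure.map_apply Path.measurable_toFun (hmeas (measurableSet_singleton x)),
        Measure.map_apply Path.measurable_toFun (hmeas (measurableSet_singleton x))]
      have hx0 : 0 ∈ insert 0 I := Finset.mem_insert_self 0 I
      -- The value off `insert 0 I` is irrelevant; `x` at time `0` serves because `Fin m` has no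
      -- default element.
      have : (Path.toFun (m := m)) ⁻¹' ((insert 0 I).restrict ⁻¹' {x}) =
          agreeOn (insert 0 I)
            (fun t => if ht : t ∈ insert 0 I then x ⟨t, ht⟩ else x ⟨0, hx0⟩) := by
        ext ω
        simp only [mem_preimage, mem_singleton_iff, agreeOn, mem_ofPred_eq]
        constructor
        · rintro rfl t ht
          rw [dif_pos ht]; rfl
        · intro h
          ext ⟨t, ht⟩
          have := h t ht
          rw [dif_pos ht] at this
          exact congrArg _ this
      rw [this, hμ.agreeOn_eq hν h0]
    have h2 := Finset.measurable_restrict₂ (X := fun _ : ℝ≥0 => Fin m) hsub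
    rw [← Finset.restrict₂_comp_restrict hsub,
      ← Measure.map_map h2 (Finset.measurable_restrict _),
      ← Measure.map_map h2 (Finset.measurable_restrict _), hJ]
  have hval : μ.map Path.toFun = ν.map Path.toFun :=
    IsProjectiveLimit.unique (P := fun I => (μ.map Path.toFun).map I.restrict)
      (fun _ => rfl) hproj
  refine Measure.ext fun s hs => ?_
  rw [Path.measurableSpace_eq_comap] at hs
  obtain ⟨S, hS, rfl⟩ := hs
  rw [← Measure.map_apply Path.measurable_toFun hS, hval, Measure.map_apply Path.measurable_toFun hS]

theorem startingAt_eval_zero (P : Measure (Path m)) [IsFiniteMeasure P]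
    (hP₀ : ∀ i : Fin m, P {ω | ω 0 = i} ≠ 0) (j k : Fin m) :
    startingAt P j {ω | ω 0 = k} = if j = k then 1 else 0 := by
  split_ifs with hjk
  · rw [hjk]
    exact cond_apply_self (hP₀ k) (measure_ne_top _ _)
  · rw [startingAt, cond_apply (Path.measurableSet_eval_eq 0 j)]
    have : {ω : Path m | ω 0 = j} ∩ {ω | ω 0 = k} = ∅ := by
      ext ω
      simp only [mem_inter_iff, mem_ofPred_eq, mem_empty_iff_false, iff_false, not_and]
      exact fun h1 h2 => hjk (h1.symm.trans h2)
    rw [this]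
    simp

/-- Markov property at a deterministic time. -/
theorem IsMarkovChain.map_shift_startingAt {B : Matrix (Fin m) (Fin m) ℝ} {P : Measure (Path m)}
    [IsFiniteMeasure P] (hP : IsMarkovChain B P) (hP₀ : ∀ i : Fin m, P {ω | ω 0 = i} ≠ 0)
    (h : ℝ≥0) (i : Fin m) :
    (startingAt P i).map (Path.shift h) =
      ∑ j, startingAt P i {ω | ω h = j} • startingAt P j := by
  have hK := hP.hasTransitions
  have hst : ∀ j, HasTransitions _ (startingAt P j) := fun j => (hK.restrict j).smul _
  have : IsProbabilityMeasure (startingAt P i) := cond_isProbabilityMeasure (hP₀ i)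
  have : IsFiniteMeasure ((startingAt P i).map (Path.shift h)) := inferInstance
  -- Both sides share the transition kernel, and both give the initial state `k` the mass `P_i(ω h =
  -- k)`.
  refine ((hst i).map_shift h).eq (HasTransitions.sum _ fun j => (hst j).smul _) fun k => ?_
  rw [Measure.map_apply (Path.measurable_shift h) (Path.measurableSet_eval_eq 0 k)]
  simp only [Measure.coe_finsetSum, Finset.sum_apply, Measure.smul_apply,
    startingAt_eval_zero P hP₀, smul_eq_mul, mul_ite, mul_one, mul_zero, Finset.sum_ite_eq',
    Finset.mem_univ, if_true]
  congr 1
  ext ω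
  simp

end Markov

/-! ### Joint measurability in path and time -/

section JointMeasurability

variable {m N : ℕ}

/-- Right-continuity: `a n t` is a grid point of mesh `1 / (n + 1)` lying to the right of `t`,
whence the `+ 1` after the floor. Evaluation at `a n t` involves countably many times and converges
to evaluation at `t`. -/
theorem Path.measurable_eval_prod : Measurable fun p : Path m × ℝ≥0 => p.1 p.2 := by
  set a : ℕ → ℝ≥0 → ℝ≥0 := fun n t => ((⌊(n + 1 : ℝ≥0) * t⌋₊ : ℝ≥0) + 1) / (n + 1)
  have hmeas : ∀ n, Measurable fun p : Path m × ℝ≥0 => p.1 (a n p.2) := fun n => by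
    have h1 : Measurable fun q : Path m × ℕ => q.1 (((q.2 : ℝ≥0) + 1) / (n + 1)) :=
      measurable_from_prod_countable_left fun k =>
        Path.measurable_eval (((k : ℝ≥0) + 1) / (n + 1))
    have h2 : Measurable fun p : Path m × ℝ≥0 => (p.1, ⌊(n + 1 : ℝ≥0) * p.2⌋₊) :=
      measurable_fst.prodMk (Nat.measurable_floor.comp (measurable_const.mul measurable_snd))
    exact h1.comp h2
  have hle : ∀ n t, t ≤ a n t := fun n t => by
    rw [le_div_iff₀ (by positivity), mul_comm]
    exact (Nat.lt_floor_add_one _).le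
  have hge : ∀ n t, a n t ≤ t + 1 / (n + 1) := fun n t => by
    have hn : (0 : ℝ≥0) < n + 1 := by positivity
    rw [div_le_iff₀ hn, add_mul t, one_div, inv_mul_cancel₀ hn.ne', mul_comm t]
    gcongr
    exact Nat.floor_le zero_le
  have hlim : ∀ t, Tendsto (fun n => a n t) atTop (𝓝 t) := fun t => by
    refine tendsto_of_tendsto_of_tendsto_of_le_of_le tendsto_const_nhds ?_
      (fun n => hle n t) (fun n => hge n t)
    have : Tendsto (fun n : ℕ => t + 1 / ((n : ℝ≥0) + 1)) atTop (𝓝 (t + 0)) :=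
      tendsto_const_nhds.add tendsto_one_div_add_atTop_nhds_zero_nat
    simpa using this
  refine measurable_of_tendsto_metrizable hmeas (tendsto_pi_nhds.2 fun p => ?_)
  exact (p.1.2 p.2).1.tendsto.comp
    (tendsto_nhdsWithin_iff.2 ⟨hlim p.2, Eventually.of_forall fun n => hle n p.2⟩)

theorem measurable_velocity_prod :
    Measurable[(borel C(ℝ≥0, Space N)).prod inferInstance]
      fun p : C(ℝ≥0, Space N) × ℝ => velocity p.1 p.2 := by
  borelize C(ℝ≥0, Space N)
  exact measurable_deriv_with_param (f := fun (γ : C(ℝ≥0, Space N)) (r : ℝ) => γ r.toNNReal)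
    (by fun_prop)

theorem measurable_eval_prod :
    Measurable[(borel C(ℝ≥0, Space N)).prod inferInstance]
      fun p : C(ℝ≥0, Space N) × ℝ≥0 => p.1 p.2 := by
  borelize C(ℝ≥0, Space N)
  exact Continuous.measurable (by fun_prop)

variable {H : Fin m → Space N → Space N → ℝ}

theorem measurable_lagrangian_family (hH : ∀ i, IsHamiltonian (H i)) :
    Measurable fun z : Fin m × (Space N × Space N) => lagrangian (H z.1) z.2.1 z.2.2 :=
  measurable_from_prod_countable_right fun i => (hH i).measurable_lagrangian

theorem measurable_eval_along {γ : Path m → C(ℝ≥0, Space N)}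
    (hγ : Measurable[inferInstance, borel C(ℝ≥0, Space N)] γ) :
    Measurable fun p : Path m × ℝ => γ p.1 p.2.toNNReal := by
  borelize C(ℝ≥0, Space N)
  have h : Measurable fun p : Path m × ℝ => (γ p.1, p.2.toNNReal) :=
    (hγ.comp measurable_fst).prodMk measurable_snd.real_toNNReal
  exact measurable_eval_prod.comp h

theorem measurable_velocity_along {γ : Path m → C(ℝ≥0, Space N)}
    (hγ : Measurable[inferInstance, borel C(ℝ≥0, Space N)] γ) :
    Measurable fun p : Path m × ℝ => velocity (γ p.1) p.2 := by
  borelize C(ℝ≥0, Space N)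
  have h : Measurable fun p : Path m × ℝ => (γ p.1, p.2) :=
    (hγ.comp measurable_fst).prodMk measurable_snd
  exact measurable_velocity_prod.comp h

theorem measurable_lagrangian_along (hH : ∀ i, IsHamiltonian (H i))
    {γ : Path m → C(ℝ≥0, Space N)} (hγ : Measurable[inferInstance, borel C(ℝ≥0, Space N)] γ) :
    Measurable fun p : Path m × ℝ =>
      lagrangian (H (p.1 p.2.toNNReal)) (γ p.1 p.2.toNNReal) (-velocity (γ p.1) p.2) := by
  have h1 : Measurable fun p : Path m × ℝ => p.1 p.2.toNNReal :=
    Path.measurable_eval_prod.comp (measurable_fst.prodMk measurable_snd.real_toNNReal)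
  have h2 : Measurable fun p : Path m × ℝ => -velocity (γ p.1) p.2 :=
    (measurable_velocity_along hγ).neg
  have h3 := (measurable_lagrangian_family hH).comp
    (h1.prodMk ((measurable_eval_along hγ).prodMk h2))
  simpa only [Function.comp_def] using h3

theorem measurable_action (hH : ∀ i, IsHamiltonian (H i))
    {γ : Path m → C(ℝ≥0, Space N)} (hγ : Measurable[inferInstance, borel C(ℝ≥0, Space N)] γ)
    (t : ℝ≥0) : Measurable fun ω => action H t ω (γ ω) :=
  measurable_eintegral_prod_right (measurable_lagrangian_along hH hγ).coe_real_ereal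

theorem measurable_terminal {u₀ : Space N → Fin m → ℝ} (hu₀ : Continuous u₀)
    {γ : Path m → C(ℝ≥0, Space N)} (hγ : Measurable[inferInstance, borel C(ℝ≥0, Space N)] γ)
    (t : ℝ≥0) : Measurable fun ω => u₀ (γ ω t) (ω t) := by
  borelize C(ℝ≥0, Space N)
  have h : Measurable fun z : Space N × Fin m => u₀ z.1 z.2 :=
    measurable_from_prod_countable_left fun i => ((continuous_apply i).comp hu₀).measurable
  have h2 : Measurable fun ω => γ ω t :=
    measurable_eval_prod.comp (hγ.prodMk (measurable_const (a := t)))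
  exact h.comp (h2.prodMk (Path.measurable_eval t))

end JointMeasurability

/-! ### Uniform bounds on the action -/

section ActionBounds

variable {m N : ℕ} {H : Fin m → Space N → Space N → ℝ}

theorem exists_forall_neg_le_lagrangian (hH : ∀ i, IsHamiltonian (H i)) :
    ∃ c : ℝ≥0, ∀ i x q, -(c : ℝ) ≤ lagrangian (H i) x q := by
  choose c hc using fun i => (hH i).exists_neg_le_lagrangian
  refine ⟨Finset.univ.sup c, fun i x q => le_trans ?_ (hc i x q)⟩
  exact neg_le_neg (NNReal.coe_le_coe.2 (Finset.le_sup (Finset.mem_univ i)))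

theorem exists_forall_lagrangian_zero_le (hH : ∀ i, IsHamiltonian (H i)) :
    ∃ c : ℝ≥0, ∀ i x, lagrangian (H i) x 0 ≤ c := by
  choose c hc using fun i => (hH i).exists_lagrangian_zero_le
  exact ⟨Finset.univ.sup c, fun i x =>
    (hc i x).trans (NNReal.coe_le_coe.2 (Finset.le_sup (Finset.mem_univ i)))⟩

theorem coe_mul_volume_Ioc (c t : ℝ≥0) :
    (((c : ℝ≥0∞) * volume.restrict (Ioc (0 : ℝ) t) univ : ℝ≥0∞) : EReal) =
      (((c * t : ℝ≥0) : ℝ) : EReal) := by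
  rw [Measure.restrict_apply_univ, Real.volume_Ioc, sub_zero, ENNReal.ofReal_coe_nnreal,
    ← ENNReal.coe_mul]
  rfl

theorem neg_le_action {c : ℝ≥0} (hc : ∀ i x q, -(c : ℝ) ≤ lagrangian (H i) x q) (t : ℝ≥0)
    (ω : Path m) (γ : ℝ≥0 → Space N) :
    -(((c * t : ℝ≥0) : ℝ) : EReal) ≤ action H t ω γ := by
  rw [← coe_mul_volume_Ioc]
  exact le_eintegral _ fun s => by exact_mod_cast hc _ _ _

theorem action_const_le {c : ℝ≥0} (hc : ∀ i x, lagrangian (H i) x 0 ≤ c) (t : ℝ≥0)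
    (ω : Path m) (x : Space N) :
    action H t ω (fun _ => x) ≤ (((c * t : ℝ≥0) : ℝ) : EReal) := by
  rw [← coe_mul_volume_Ioc]
  refine eintegral_le _ fun s => ?_
  have : velocity (fun _ => x) s = 0 := by simp [velocity]
  rw [this, neg_zero]
  exact_mod_cast hc _ _

end ActionBounds

/-! ### Concatenation of curves -/

section Concatenation

variable {m N : ℕ} {H : Fin m → Space N → Space N → ℝ}

theorem eintegral_comp_emb {X Y : Type*} [MeasurableSpace X] [MeasurableSpace Y] {μ : Measure X}
    {ν : Measure Y} {T : X → Y} (hT : MeasurePreserving T μ ν) (hemb : MeasurableEmbedding T)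
    (f : Y → EReal) : eintegral μ (fun x => f (T x)) = eintegral ν f := by
  unfold eintegral
  rw [hT.lintegral_comp_emb hemb (fun y => (f y).toENNReal),
    hT.lintegral_comp_emb hemb (fun y => (-f y).toENNReal)]

theorem action_concat {c : ℝ≥0} (hc : ∀ i x q, -(c : ℝ) ≤ lagrangian (H i) x q) (h t : ℝ≥0)
    (ω : Path m) {ξ γ η : ℝ≥0 → Space N} (hξγ : ∀ s ≤ h, ξ s = γ s) (hξη : ∀ s, ξ (h + s) = η s) :
    action H (h + t) ω ξ = action H h ω γ + action H t (ω.shift h) η := by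
  set F : ℝ → EReal := fun s =>
    ((lagrangian (H (ω s.toNNReal)) (ξ s.toNNReal) (-velocity ξ s) : ℝ) : EReal)
  have hF : ∀ s, -((c : ℝ) : EReal) ≤ F s := fun s =>
    EReal.coe_le_coe_iff.2 (hc (ω s.toNNReal) (ξ s.toNNReal) (-velocity ξ s))
  have hsplit : volume.restrict (Ioc (0 : ℝ) ((h + t : ℝ≥0) : ℝ)) =
      volume.restrict (Ioc (0 : ℝ) h) + volume.restrict (Ioc (h : ℝ) (h + t)) := by
    rw [← Measure.restrict_union (Ioc_disjoint_Ioc_of_le le_rfl) measurableSet_Ioc,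
      Ioc_union_Ioc_eq_Ioc h.coe_nonneg (by simp), NNReal.coe_add]
  have h1 : eintegral (volume.restrict (Ioc (0 : ℝ) h)) F = action H h ω γ := by
    refine eintegral_congr_ae ?_
    -- At `s = h` the two-sided derivative of `ξ` also depends on `η`; this one time is discarded as
    -- a null set.
    have hne : ∀ᵐ s ∂(volume.restrict (Ioc (0 : ℝ) h)), s ≠ (h : ℝ) :=
      ae_restrict_of_ae (Measure.ae_ne volume (h : ℝ))
    filter_upwards [hne, ae_restrict_mem measurableSet_Ioc] with s hs hmem
    have hsh : s < h := lt_of_le_of_ne hmem.2 hs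
    have hv : velocity ξ s = velocity γ s := by
      refine Filter.EventuallyEq.deriv_eq ?_
      filter_upwards [Iio_mem_nhds hsh] with r hr
      exact hξγ _ (Real.toNNReal_le_iff_le_coe.2 (mem_Iio.1 hr).le)
    simp only [F]
    rw [hv, hξγ _ (Real.toNNReal_le_iff_le_coe.2 hmem.2)]
  have h2 : eintegral (volume.restrict (Ioc (h : ℝ) (h + t))) F =
      action H t (ω.shift h) η := by
    have hemb : MeasurableEmbedding fun s : ℝ => (h : ℝ) + s :=
      (MeasurableEquiv.addLeft (h : ℝ)).measurableEmbedding
    have hpre : (fun s : ℝ => (h : ℝ) + s) ⁻¹' Ioc (h : ℝ) (h + t) = Ioc (0 : ℝ) t := by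
      ext s; simp
    have hT := (measurePreserving_add_left volume (h : ℝ)).restrict_preimage_emb hemb
      (Ioc (h : ℝ) (h + t))
    rw [hpre] at hT
    rw [← eintegral_comp_emb hT hemb]
    refine eintegral_congr_ae ?_
    filter_upwards [ae_restrict_mem measurableSet_Ioc] with s hs
    have hadd : ∀ r : ℝ, 0 ≤ r → ((h : ℝ) + r).toNNReal = h + r.toNNReal := fun r hr => by
      rw [Real.toNNReal_add h.coe_nonneg hr, Real.toNNReal_coe]
    have hv : velocity ξ (h + s) = velocity η s := by
      rw [velocity, ← deriv_comp_const_add]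
      refine Filter.EventuallyEq.deriv_eq ?_
      filter_upwards [Ioi_mem_nhds hs.1] with r hr
      rw [hadd r (mem_Ioi.1 hr).le, hξη]
    simp only [F]
    rw [hv, hadd s hs.1.le, hξη, Path.shift_apply]
  rw [← h1, ← h2, ← eintegral_add_measure, ← hsplit]
  · rfl
  · exact lintegral_toENNReal_neg_ne_top _ hF

/-- Follow `γ` up to time `h`, then the curve `η j` driven by the shifted path, where `j` is the
state at time `h`. -/
def concat (h : ℝ≥0) (γ : C(ℝ≥0, Space N)) (η : Fin m → Path m → C(ℝ≥0, Space N)) (ω : Path m) :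
    C(ℝ≥0, Space N) :=
  γ.comp ⟨fun s => min s h, by fun_prop⟩ +
    ((η (ω h) (ω.shift h)).comp ⟨fun s => s - h, by fun_prop⟩ + ContinuousMap.const _ (-γ h))

variable {h : ℝ≥0} {γ : C(ℝ≥0, Space N)} {η : Fin m → Path m → C(ℝ≥0, Space N)}

/-- The sum replaces a case split, so continuity is automatic. Before `h` the truncated `s - h`
freezes `η` at its start; after `h` the `min` freezes `γ` at `γ h`. In both cases `-γ h` cancels the
frozen term, the first time because `η` starts at `γ h`. -/
theorem concat_apply (s : ℝ≥0) (ω : Path m) :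
    concat h γ η ω s = γ (min s h) + (η (ω h) (ω.shift h) (s - h) + -γ h) := rfl

theorem concat_of_le (hη : ∀ j ω, η j ω 0 = γ h) {s : ℝ≥0} (hs : s ≤ h) (ω : Path m) :
    concat h γ η ω s = γ s := by
  rw [concat_apply, min_eq_left hs, tsub_eq_zero_of_le hs, hη]
  simp

theorem concat_add (s : ℝ≥0) (ω : Path m) :
    concat h γ η ω (h + s) = η (ω h) (ω.shift h) s := by
  rw [concat_apply, min_eq_right le_self_add, add_tsub_cancel_left]
  abel

theorem measurable_concat_aux (hη : ∀ j, IsAdmissible (η j)) :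
    Measurable[inferInstance, borel C(ℝ≥0, Space N)]
      fun ω : Path m => η (ω h) (ω.shift h) := by
  borelize C(ℝ≥0, Space N)
  have h1 : Measurable fun p : Fin m × Path m => η p.1 p.2 :=
    measurable_from_prod_countable_right fun j => (hη j).measurable
  exact h1.comp ((Path.measurable_eval h).prodMk (Path.measurable_shift h))

/-- Up to time `h` the curve is deterministic. Afterwards its value at `h + r` depends only on `ω h`
and on the shifted path on `[0, r]`, that is, on `ω` over `[h, h + r]`. Finiteness of the state
space makes the absolute continuity uniform over the `η j`. -/
theorem isAdmissible_concat (hγ : IsCurve γ) (hη : ∀ j, IsAdmissible (η j))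
    (hη0 : ∀ j ω, η j ω 0 = γ h) : IsAdmissible (concat h γ η) where
  measurable := by
    have haux := measurable_concat_aux (h := h) hη
    borelize C(ℝ≥0, Space N)
    have hc : Continuous fun ζ : C(ℝ≥0, Space N) =>
        γ.comp ⟨fun s => min s h, by fun_prop⟩ +
          (ζ.comp ⟨fun s => s - h, by fun_prop⟩ + ContinuousMap.const _ (-γ h)) :=
      continuous_const.add ((ContinuousMap.continuous_precomp _).add continuous_const)
    exact hc.measurable.comp haux
  equiLocallyAC := by
    have hsub : ∀ s t : ℝ≥0, s ≤ t → ((t - h : ℝ≥0) : ℝ) - (s - h : ℝ≥0) ≤ t - s := by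
      intro s t hst
      have hst' : (s : ℝ) ≤ t := hst
      simp only [NNReal.coe_sub_def]
      rcases max_cases ((t : ℝ) - h) 0 with h1 | h1 <;>
        rcases max_cases ((s : ℝ) - h) 0 with h2 | h2 <;> linarith
    have hmin : ∀ s t : ℝ≥0, s ≤ t → ((min t h : ℝ≥0) : ℝ) - (min s h : ℝ≥0) ≤ t - s := by
      intro s t hst
      have hst' : (s : ℝ) ≤ t := hst
      simp only [NNReal.coe_min]
      rcases min_cases (t : ℝ) h with h1 | h1 <;>
        rcases min_cases (s : ℝ) h with h2 | h2 <;> linarith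
    have h1 : EquiLocallyAC fun (_ : Path m) (t : ℝ≥0) => γ (min t h) :=
      hγ.equiLocallyAC.comp_time (fun s t hst => min_le_min_right h hst)
        (fun t => min_le_left t h) hmin
    have h2 : EquiLocallyAC fun (ω : Path m) (t : ℝ≥0) => η (ω h) (ω.shift h) (t - h) :=
      ((EquiLocallyAC.of_finite fun j => (hη j).equiLocallyAC).comp_param
        fun ω : Path m => (ω h, ω.shift h)).comp_time
        (fun s t hst => tsub_le_tsub_right hst h) (fun t => tsub_le_self) hsub
    exact h1.add (h2.add (equiLocallyAC_const _))
  nonanticipating := by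
    intro t ω₁ ω₂ hω s hs
    rcases le_total s h with hsh | hsh
    · rw [concat_of_le hη0 hsh, concat_of_le hη0 hsh]
    · obtain ⟨r, rfl⟩ := exists_add_of_le hsh
      rw [concat_add, concat_add, hω h (hsh.trans hs)]
      exact (hη _).nonanticipating r _ _ (fun q hq => hω (h + q) ((add_le_add_right hq h).trans hs)) r
        le_rfl

end Concatenation

/-! ### The value function and sub-optimality -/

section ValueFunction

variable {m N : ℕ} {H : Fin m → Space N → Space N → ℝ} {P : Measure (Path m)}
  {u₀ : Space N → Fin m → ℝ}

/-- The cost of the family of curves `γ` along the path `ω`. -/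
noncomputable def cost (H : Fin m → Space N → Space N → ℝ) (u₀ : Space N → Fin m → ℝ) (t : ℝ≥0)
    (γ : Path m → C(ℝ≥0, Space N)) (ω : Path m) : EReal :=
  ((u₀ (γ ω t) (ω t) : ℝ) : EReal) + action H t ω (γ ω)

theorem isAdmissible_const (x : Space N) :
    IsAdmissible fun _ : Path m => ContinuousMap.const ℝ≥0 x where
  measurable := by
    borelize C(ℝ≥0, Space N)
    exact measurable_const
  equiLocallyAC := equiLocallyAC_const x
  nonanticipating := fun _ _ _ _ _ _ => rfl

theorem neg_le_cost {C c : ℝ≥0} (hC : ∀ x i, |u₀ x i| ≤ C)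
    (hc : ∀ i x q, -(c : ℝ) ≤ lagrangian (H i) x q) (t : ℝ≥0) (γ : Path m → C(ℝ≥0, Space N))
    (ω : Path m) : -(((C + c * t : ℝ≥0) : ℝ) : EReal) ≤ cost H u₀ t γ ω := by
  have h1 : ((-(C : ℝ) : ℝ) : EReal) ≤ ((u₀ (γ ω t) (ω t) : ℝ) : EReal) :=
    EReal.coe_le_coe_iff.2 (abs_le.1 (hC _ _)).1
  have h2 := add_le_add h1 (neg_le_action hc t ω (γ ω))
  rwa [← EReal.coe_neg, ← EReal.coe_add, ← neg_add, ← NNReal.coe_add, EReal.coe_neg] at h2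

theorem measurable_cost (hH : ∀ i, IsHamiltonian (H i)) (hu₀ : Continuous u₀) (t : ℝ≥0)
    {γ : Path m → C(ℝ≥0, Space N)} (hγ : Measurable[inferInstance, borel C(ℝ≥0, Space N)] γ) :
    Measurable (cost H u₀ t γ) :=
  (measurable_terminal hu₀ hγ t).coe_real_ereal.add (measurable_action hH hγ t)

theorem coe_mul_measure_univ {X : Type*} [MeasurableSpace X] (μ : Measure X)
    [IsProbabilityMeasure μ] (c : ℝ≥0) :
    (((c : ℝ≥0∞) * μ univ : ℝ≥0∞) : EReal) = ((c : ℝ) : EReal) := by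
  rw [measure_univ, mul_one]
  rfl

theorem isProbabilityMeasure_startingAt [IsFiniteMeasure P]
    (hP₀ : ∀ i : Fin m, P {ω | ω 0 = i} ≠ 0) (i : Fin m) :
    IsProbabilityMeasure (startingAt P i) :=
  cond_isProbabilityMeasure (hP₀ i)

theorem neg_le_laxOleinikE [IsFiniteMeasure P] (hP₀ : ∀ i : Fin m, P {ω | ω 0 = i} ≠ 0)
    {C c : ℝ≥0} (hC : ∀ x i, |u₀ x i| ≤ C) (hc : ∀ i x q, -(c : ℝ) ≤ lagrangian (H i) x q)
    (t : ℝ≥0) (x : Space N) (i : Fin m) :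
    -(((C + c * t : ℝ≥0) : ℝ) : EReal) ≤ laxOleinikE H P u₀ t x i := by
  have := isProbabilityMeasure_startingAt hP₀ i
  refine le_iInf₂ fun γ _ => ?_
  rw [← coe_mul_measure_univ (startingAt P i)]
  exact le_eintegral _ (neg_le_cost hC hc t γ)

theorem laxOleinikE_lt_top [IsFiniteMeasure P] (hP₀ : ∀ i : Fin m, P {ω | ω 0 = i} ≠ 0)
    (hH : ∀ i, IsHamiltonian (H i)) {C : ℝ≥0} (hC : ∀ x i, |u₀ x i| ≤ C)
    (t : ℝ≥0) (x : Space N) (i : Fin m) : laxOleinikE H P u₀ t x i < ⊤ := by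
  have := isProbabilityMeasure_startingAt hP₀ i
  obtain ⟨d, hd⟩ := exists_forall_lagrangian_zero_le hH
  refine (iInf₂_le (fun _ => ContinuousMap.const ℝ≥0 x)
    ⟨isAdmissible_const x, fun _ => rfl⟩).trans_lt ?_
  refine (eintegral_le (c := C + d * t) _ fun ω => ?_).trans_lt
    (by rw [coe_mul_measure_univ]; exact EReal.coe_lt_top _)
  rw [NNReal.coe_add, EReal.coe_add]
  exact add_le_add (EReal.coe_le_coe_iff.2 (abs_le.1 (hC _ _)).2) (action_const_le hd t ω x)

theorem coe_laxOleinik [IsFiniteMeasure P] (hP₀ : ∀ i : Fin m, P {ω | ω 0 = i} ≠ 0)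
    (hH : ∀ i, IsHamiltonian (H i)) {C : ℝ≥0} (hC : ∀ x i, |u₀ x i| ≤ C)
    (t : ℝ≥0) (x : Space N) (i : Fin m) :
    ((laxOleinik H P u₀ t x i : ℝ) : EReal) = laxOleinikE H P u₀ t x i := by
  obtain ⟨c, hc⟩ := exists_forall_neg_le_lagrangian hH
  refine EReal.coe_toReal (laxOleinikE_lt_top hP₀ hH hC t x i).ne fun hbot => ?_
  have h := neg_le_laxOleinikE (P := P) hP₀ hC hc t x i
  rw [hbot, le_bot_iff, ← EReal.coe_neg] at h
  exact EReal.coe_ne_bot _ h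

theorem integrable_eval (μ : Measure (Path m)) [IsFiniteMeasure μ] (v : Fin m → ℝ) (h : ℝ≥0) :
    Integrable (fun ω : Path m => v (ω h)) μ := by
  refine Integrable.of_bound ((measurable_of_countable v).comp
    (Path.measurable_eval h)).aestronglyMeasurable (∑ j, ‖v j‖) (Eventually.of_forall fun ω => ?_)
  exact Finset.single_le_sum (f := fun j => ‖v j‖) (fun j _ => norm_nonneg _)
    (Finset.mem_univ (ω h))

/-- Expectation at the random state reached at time `h` after restarting the chain. -/
theorem eintegral_shift_le {B : Matrix (Fin m) (Fin m) ℝ} [IsFiniteMeasure P]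
    (hP : IsMarkovChain B P) (hP₀ : ∀ i : Fin m, P {ω | ω 0 = i} ≠ 0) (h : ℝ≥0) (i : Fin m)
    {F : Path m → EReal} (hF : Measurable F) {c : ℝ≥0} (hc : ∀ ω, -((c : ℝ) : EReal) ≤ F ω)
    {v : Fin m → ℝ} (hv : ∀ j, eintegral (startingAt P j) F ≤ ((v j : ℝ) : EReal)) :
    eintegral (startingAt P i) (fun ω => F (ω.shift h)) ≤
      ((∫ ω, v (ω h) ∂(startingAt P i) : ℝ) : EReal) := by
  have hprob := fun j => isProbabilityMeasure_startingAt hP₀ j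
  -- After adding `c` everything is nonnegative, so `ENNReal.ofReal` truncates nothing.
  have hvc : ∀ j, 0 ≤ v j + c := fun j => by
    have h1 := (le_eintegral (startingAt P j) hc).trans (hv j)
    rw [coe_mul_measure_univ, ← EReal.coe_neg, EReal.coe_le_coe_iff] at h1
    linarith
  have hFj : ∀ j, ∫⁻ ω, (F ω + ((c : ℝ) : EReal)).toENNReal ∂(startingAt P j) ≤
      ENNReal.ofReal (v j + c) := fun j => by
    have h1 := hv j
    rw [eintegral_eq_lintegral_sub _ hF hc, coe_mul_measure_univ,
      EReal.sub_le_iff_le_add (Or.inl (EReal.coe_ne_bot _)) (Or.inl (EReal.coe_ne_top _)),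
      ← EReal.coe_add] at h1
    rw [← EReal.coe_ennreal_le_coe_ennreal_iff, EReal.coe_ennreal_ofReal, max_eq_left (hvc j)]
    exact h1
  have hfib : (∫⁻ ω, ENNReal.ofReal (v (ω h) + c) ∂(startingAt P i)) =
      ∑ j, startingAt P i {ω | ω h = j} * ENNReal.ofReal (v j + c) := by
    rw [← lintegral_map (f := fun j => ENNReal.ofReal (v j + c)) (measurable_of_countable _)
      (Path.measurable_eval h), lintegral_fintype]
    refine Finset.sum_congr rfl fun j _ => ?_
    rw [Measure.map_apply (Path.measurable_eval h) (measurableSet_singleton j), mul_comm]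
    rfl
  have hint := integrable_eval (startingAt P i) v h
  have hbound : ∫⁻ ω, (F (ω.shift h) + ((c : ℝ) : EReal)).toENNReal ∂(startingAt P i) ≤
      ENNReal.ofReal (∫ ω, v (ω h) ∂(startingAt P i) + c) := by
    have hFc : Measurable fun ω => (F ω + ((c : ℝ) : EReal)).toENNReal :=
      (hF.add measurable_const).ereal_toENNReal
    have hI : ∫ ω, v (ω h) ∂(startingAt P i) + c = ∫ ω, (v (ω h) + c) ∂(startingAt P i) := by
      rw [integral_add hint (integrable_const _), integral_const]
      simp
    have hR : ENNReal.ofReal (∫ ω, (v (ω h) + c) ∂(startingAt P i)) =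
        ∑ j, startingAt P i {ω | ω h = j} * ENNReal.ofReal (v j + c) :=
      (ofReal_integral_eq_lintegral_ofReal (hint.add (integrable_const (c : ℝ)))
        (Eventually.of_forall fun ω => hvc _)).trans hfib
    -- The Markov property turns the law of the shifted path into a mixture of the `startingAt P j`,
    -- to be compared state by state.
    rw [← lintegral_map hFc (Path.measurable_shift h), hP.map_shift_startingAt hP₀,
      lintegral_finsetSum_measure, hI, hR]
    simp only [lintegral_smul_measure, smul_eq_mul]
    exact Finset.sum_le_sum fun j _ => by gcongr; exact hFj j
  have hI0 : 0 ≤ ∫ ω, v (ω h) ∂(startingAt P i) + c := by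
    have := integral_mono (μ := startingAt P i) (integrable_const (-(c : ℝ))) hint
      fun ω => by have := hvc (ω h); simp only; linarith
    rw [integral_const] at this
    simp at this
    linarith
  have hFs : Measurable fun ω : Path m => F (ω.shift h) := hF.comp (Path.measurable_shift h)
  rw [eintegral_eq_lintegral_sub _ hFs fun ω => hc _,
    coe_mul_measure_univ,
    EReal.sub_le_iff_le_add (Or.inl (EReal.coe_ne_bot _)) (Or.inl (EReal.coe_ne_top _)),
    ← EReal.coe_add]
  rw [← EReal.coe_ennreal_le_coe_ennreal_iff, EReal.coe_ennreal_ofReal, max_eq_left hI0] at hbound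
  exact hbound

theorem exists_admissible_lt [IsFiniteMeasure P] (hP₀ : ∀ i : Fin m, P {ω | ω 0 = i} ≠ 0)
    (hH : ∀ i, IsHamiltonian (H i)) {C : ℝ≥0} (hC : ∀ x i, |u₀ x i| ≤ C) (t : ℝ≥0)
    (x : Space N) (i : Fin m) {ε : ℝ} (hε : 0 < ε) :
    ∃ η : Path m → C(ℝ≥0, Space N), IsAdmissible η ∧ (∀ ω, η ω 0 = x) ∧
      eintegral (startingAt P i) (cost H u₀ t η) ≤
        ((laxOleinik H P u₀ t x i + ε : ℝ) : EReal) := by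
  have hlt : laxOleinikE H P u₀ t x i < ((laxOleinik H P u₀ t x i + ε : ℝ) : EReal) := by
    rw [← coe_laxOleinik hP₀ hH hC, EReal.coe_lt_coe_iff]
    linarith
  obtain ⟨η, hη⟩ := iInf_lt_iff.1 hlt
  obtain ⟨hη', hlt'⟩ := iInf_lt_iff.1 hη
  exact ⟨η, hη'.1, hη'.2, hlt'.le⟩

theorem subOptimality_laxOleinik {B : Matrix (Fin m) (Fin m) ℝ} [IsFiniteMeasure P]
    (hP : IsMarkovChain B P) (hP₀ : ∀ i : Fin m, P {ω | ω 0 = i} ≠ 0)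
    (hH : ∀ i, IsHamiltonian (H i)) (hu₀ : Continuous u₀) {C : ℝ≥0}
    (hC : ∀ x i, |u₀ x i| ≤ C) : SubOptimality H P (laxOleinik H P u₀) := by
  intro t h i γ hγ
  have hprob := fun j => isProbabilityMeasure_startingAt hP₀ j
  obtain ⟨c, hc⟩ := exists_forall_neg_le_lagrangian hH
  set u := laxOleinik H P u₀
  set A := eintegral (startingAt P i) fun ω => action H h ω γ
  set I : ℝ := ∫ ω, u t (γ h) (ω h) ∂(startingAt P i)
  -- Stated additively, so that `A = ⊤` needs no care until the end.
  have hmain : ∀ ε : ℝ, 0 < ε → ((u (h + t) (γ 0) i : ℝ) : EReal) ≤ A + ((I + ε : ℝ) : EReal) := by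
    intro ε hε
    choose η hadm hstart hle using fun j => exists_admissible_lt hP₀ hH hC t (γ h) j hε
    set γc : C(ℝ≥0, Space N) := ⟨γ, hγ.continuous⟩
    -- Selecting the curve by `ω 0` gives one functional for all states: on the shifted path `ω 0`
    -- becomes `ω h`, and under `startingAt P j` it is almost surely `j`.
    set F : Path m → EReal := fun ω => cost H u₀ t (fun ω => η (ω 0) ω) ω
    have hη0 : Measurable[inferInstance, borel C(ℝ≥0, Space N)]
        fun ω : Path m => η (ω 0) ω := by
      borelize C(ℝ≥0, Space N)
      have h1 : Measurable fun p : Fin m × Path m => η p.1 p.2 :=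
        measurable_from_prod_countable_right fun j => (hadm j).measurable
      exact h1.comp ((Path.measurable_eval 0).prodMk measurable_id)
    have hF : Measurable F := measurable_cost hH hu₀ t hη0
    have hFc : ∀ ω, -(((C + c * t : ℝ≥0) : ℝ) : EReal) ≤ F ω := neg_le_cost hC hc t _
    have hFv : ∀ j, eintegral (startingAt P j) F ≤ ((u t (γ h) j + ε : ℝ) : EReal) := fun j => by
      refine le_of_eq_of_le (eintegral_congr_ae ?_) (hle j)
      filter_upwards [ae_cond_mem (μ := P) (Path.measurableSet_eval_eq 0 j)] with ω hω
      have hω' : ω 0 = j := hω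
      simp only [F, cost, hω']
    have hshift := eintegral_shift_le hP hP₀ h i hF hFc hFv
    have hI : ∫ ω, (u t (γ h) (ω h) + ε) ∂(startingAt P i) = I + ε := by
      have hint := integrable_eval (startingAt P i) (u t (γ h)) h
      rw [integral_add hint (integrable_const _), integral_const]
      simp [I]
    rw [hI] at hshift
    have hconcat : ∀ ω, cost H u₀ (h + t) (concat h γc η) ω =
        action H h ω γ + F (ω.shift h) := fun ω => by
      have hact := action_concat hc h t ω (ξ := concat h γc η ω) (γ := γ)
        (η := η (ω h) (ω.shift h)) (fun s hs => concat_of_le hstart hs ω)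
        (fun s => concat_add s ω)
      have hzero : (ω.shift h) 0 = ω h := by rw [Path.shift_apply, add_zero]
      simp only [F, cost]
      rw [hact, concat_add, hzero, Path.shift_apply, ← add_assoc, ← add_assoc,
        add_comm (action H h ω γ)]
    have hadmc : IsAdmissible (concat h γc η) := isAdmissible_concat hγ hadm hstart
    have hA : Measurable fun ω : Path m => action H h ω γ := by
      have hconst : Measurable[inferInstance, borel C(ℝ≥0, Space N)]
          fun _ : Path m => γc := by
        borelize C(ℝ≥0, Space N)
        exact measurable_const
      exact measurable_action hH hconst h
    have hupper : laxOleinikE H P u₀ (h + t) (γ 0) i ≤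
        eintegral (startingAt P i) (cost H u₀ (h + t) (concat h γc η)) :=
      iInf₂_le (concat h γc η) ⟨hadmc, fun ω => concat_of_le hstart zero_le ω⟩
    have hcost : eintegral (startingAt P i) (cost H u₀ (h + t) (concat h γc η)) =
        A + eintegral (startingAt P i) fun ω => F (ω.shift h) := by
      rw [funext hconcat]
      exact eintegral_add _ hA (hF.comp (Path.measurable_shift h))
        (fun ω => neg_le_action hc h ω γ) fun ω => hFc _
    rw [coe_laxOleinik hP₀ hH hC]
    exact (hupper.trans_eq hcost).trans (add_le_add le_rfl hshift)
  rw [add_comm t h]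
  have hAbot : -(((c * h : ℝ≥0) : ℝ) : EReal) ≤ A := by
    rw [← coe_mul_measure_univ (startingAt P i)]
    exact le_eintegral _ fun ω => neg_le_action hc h ω γ
  induction hA : A with
  | bot =>
    rw [hA, le_bot_iff, ← EReal.coe_neg] at hAbot
    exact absurd hAbot (EReal.coe_ne_bot _)
  | top => exact le_top
  | coe a =>
    rw [EReal.coe_le_coe_iff]
    refine le_of_forall_pos_le_add fun ε hε => ?_
    have := hmain ε hε
    rw [hA, ← EReal.coe_add, EReal.coe_le_coe_iff] at this
    linarith

end ValueFunction

end RandomLaxOleinik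

/-- Since `EReal.toReal` sends both infinities to `0`, the first conjunct is what expresses
finiteness. -/
theorem mainTheorem5 {m N : ℕ}
    (H : Fin m → RandomLaxOleinik.Space N → RandomLaxOleinik.Space N → ℝ)
    (hH : ∀ i, RandomLaxOleinik.IsHamiltonian (H i))
    (B : Matrix (Fin m) (Fin m) ℝ) (hB : RandomLaxOleinik.IsCoupling B)
    (P : MeasureTheory.Measure (RandomLaxOleinik.Path m)) [MeasureTheory.IsProbabilityMeasure P]
    (hP : RandomLaxOleinik.IsMarkovChain B P)
    (hP₀ : ∀ i : Fin m, P {ω | ω 0 = i} ≠ 0)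
    (u₀ : RandomLaxOleinik.Space N → Fin m → ℝ) (hu₀ : Continuous u₀)
    (hu₀b : ∃ C : ℝ, ∀ x i, |u₀ x i| ≤ C) :
    (∀ t x i, ((RandomLaxOleinik.laxOleinik H P u₀ t x i : ℝ) : EReal) =
      RandomLaxOleinik.laxOleinikE H P u₀ t x i) ∧
    RandomLaxOleinik.SubOptimality H P (RandomLaxOleinik.laxOleinik H P u₀) := by
  obtain ⟨C, hC⟩ := hu₀b
  have hC' : ∀ x i, |u₀ x i| ≤ C.toNNReal := fun x i => (hC x i).trans (Real.le_coe_toNNReal C)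
  exact ⟨RandomLaxOleinik.coe_laxOleinik hP₀ hH hC',
    RandomLaxOleinik.subOptimality_laxOleinik hP hP₀ hH hu₀ hC'⟩
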